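/- Conventions. A signature $\sigma=(S,M,V)$ consists of a set $S$ of sorts, a set $M$ of function symbols $f\colon a_1\cdots a_n\to b$ ($n\ge 0$, $a_i,b\in S$) and a set $V$ of sorted variables with countably infinitely many variables of each sort. For a term $t$, $\tau(t)\in V^*$ is the word of its variables in order of occurrence, with repetitions. A context is a word in $V^*$ without repeated letters; $\mathrm{Var}(v)$ is the set of letters of $v$. A context structure on $V$ is a relation $R$ between contexts and words such that (1) $cRc$ for every context $c$; (2) $cRv$ implies $\mathrm{Var}(v)\subseteq\mathrm{Var}(c)$; (3) $cRv^1\cdots v^n$ and $v^iRw^i$ for all $i\le n$ imply $cRw^1\cdots w^n$; (4) if $cRv$, $s\colon\mathrm{Var}(c)\to V^*$ and $dRs(c)$, then $dRs(v)$, where $s$ is extended to words by concatenation. $R$ is modelable if $cRv^1\cdots v^n$ implies that there are contexts $c^1,\dots,c^n$ with $cRc^1\cdots c^n$ and $c^iRv^i$ for all $i$; $R$ is balanced if $cRv$ implies $\mathrm{Var}(c)=\mathrm{Var}(v)$; $R$ is cartesian if $cRv$ holds exactly when $\mathrm{Var}(v)\subseteq\mathrm{Var}(c)$, for all contexts $c$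 and words $v$. A terminal $R$-context of a word $v$ is a context $c$ such that for all contexts $w$: $wRc$ if and only if $wRv$. An $R$-equation $t_1\approx_v t_2$ consists of two terms of the same sort and a context $v$ with $vR\tau(t_1)$ and $vR\tau(t_2)$; an $R$-theory is a set of $R$-equations. The set of equations deducible from $E$ (written $E\vdash_R$) is the smallest set $D$ of $R$-equations that contains $E$, contains $t\approx_v t$ whenever $vR\tau(t)$, is symmetric and transitive (for fixed $v$), and satisfies: if $t_1\approx_v t_2\in D$ with $v=v_1\cdots v_n$, if $s_1,s_2$ are sort-preserving assignments of terms to $v_1,\dots,v_n$, if $w,w_1,\dots,w_n$ are contexts with $wRw_1\cdots w_n$ and $w_iR\tau(s_1(v_i))$, $w_iR\tau(s_2(v_i))$, and if $s_1(v_i)\approx_{w_i}s_2(v_i)\in D$ for all $i$, then $s_1(t_1)\approx_w s_2(t_2)\in D$. A model $m$ in the cartesian multicategory $\mathbf{Set}$ assigns to each sort a (possibly empty) set and to each $f\colon a_1\cdots a_n\to b$ a function $m(a_1)\times\cdots\times m(a_n)\to m(b)$; it satisfies $t_1\approx_v t_2$ if the two induced functions $m_v(t_1),m_v(t_2)$ on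 $m_v=\prod_{i}m(\mathrm{sort}(v_i))$ are equal. $E\vDash_{\mathbf{Set}}\varphi$ means that every model in $\mathbf{Set}$ that satisfies all equations in $E$ satisfies $\varphi$. Theorem (Set-Completeness). Let $\sigma=(S,M,V)$ be a signature and let $R$ be a modelable context structure on $V$ such that every word that has an $R$-context has a terminal $R$-context. Assume that $R$ is balanced or that $R$ is the cartesian context structure. Let $E\cup\{\varphi\}$ be an $R$-theory. Then $$E\vdash_R\varphi\quad\text{if and only if}\quad E\vDash_{\mathbf{Set}}\varphi .$$ -/

import Mathlib

universe u

/-- A (multisorted) signature: a set of sorts, a set of function symbols `f : a₁ ⋯ aₙ → b`, and a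
set of sorted variables with countably infinitely many variables of every sort. Constant symbols are
the function symbols with empty domain. -/
structure Signature where
  Srt : Type u
  Op : Type u
  dom : Op → List Srt
  cod : Op → Srt
  V : Type u
  varSort : V → Srt
  countable_fiber : ∀ s : Srt, Countable {x : V // varSort x = s}
  infinite_fiber : ∀ s : Srt, Infinite {x : V // varSort x = s}

/-- A context structure on a set `V` of letters: a relation between contexts (words without
repeated letters) and words. In `subst`, only the values of `s` on the letters of `c` matter. -/
@[ext]
structure ContextStructure (V : Type u) where
  rel : List V → List V → Prop
  nodup : ∀ {c v : List V}, rel c v → c.Nodup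
  refl : ∀ {c : List V}, c.Nodup → rel c c
  subset : ∀ {c v : List V}, rel c v → v ⊆ c
  comp : ∀ {c : List V} {vs ws : List (List V)},
    rel c vs.flatten → List.Forall₂ rel vs ws → rel c ws.flatten
  subst : ∀ {c v d : List V} (s : V → List V),
    rel c v → rel d (c.flatMap s) → rel d (v.flatMap s)

namespace ContextStructure

variable {V : Type u}

/-- If `c` is an `R`-context of a concatenation `v¹⋯vⁿ`, then there are `R`-contexts `cⁱ` of the
`vⁱ` such that `c` is an `R`-context of `c¹⋯cⁿ`. -/
def Modelable (R : ContextStructure V) : Prop :=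
  ∀ (c : List V) (vs : List (List V)), R.rel c vs.flatten →
    ∃ cs : List (List V), R.rel c cs.flatten ∧ List.Forall₂ R.rel cs vs

/-- Every `R`-context of a word has exactly the letters of that word. -/
def Balanced (R : ContextStructure V) : Prop :=
  ∀ c v : List V, R.rel c v → ∀ x : V, x ∈ c ↔ x ∈ v

/-- The context `c` is a terminal `R`-context of the word `v`. -/
def IsTerminalContext (R : ContextStructure V) (c v : List V) : Prop :=
  c.Nodup ∧ ∀ w : List V, w.Nodup → (R.rel w c ↔ R.rel w v)

/-- Every `R`-word, i.e. every word that has an `R`-context, has a terminal `R`-context. -/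
def HasTerminalContexts (R : ContextStructure V) : Prop :=
  ∀ v : List V, (∃ c, R.rel c v) → ∃ c, R.IsTerminalContext c v

/-- The cartesian context structure: a context `c` is related to `v` if and only if all letters of
`v` occur in `c`. -/
def cartesian (V : Type u) : ContextStructure V where
  rel c v := c.Nodup ∧ v ⊆ c
  nodup h := h.1
  refl h := ⟨h, List.Subset.refl _⟩
  subset h := h.2
  comp := by
    intro c vs ws h hf
    refine ⟨h.1, ?_⟩
    have key : ws.flatten ⊆ vs.flatten := by
      clear h
      induction hf with
      | nil => simp
      | cons hab _ ih =>
        intro x hx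
        simp only [List.flatten_cons, List.mem_append] at hx ⊢
        exact hx.imp (fun h => hab.2 h) (fun h => ih h)
    exact fun x hx => h.2 (key hx)
  subst := by
    intro c v d s h hd
    refine ⟨hd.1, fun y hy => hd.2 ?_⟩
    obtain ⟨x, hx, hxy⟩ := List.mem_flatMap.1 hy
    exact List.mem_flatMap.2 ⟨x, h.2 hx, hxy⟩

end ContextStructure

/-- Sorted terms. -/
inductive Term (σ : Signature.{u}) : σ.Srt → Type u
  | var (x : σ.V) : Term σ (σ.varSort x)
  | app (f : σ.Op) (ts : ∀ i : Fin (σ.dom f).length, Term σ ((σ.dom f).get i)) : Term σ (σ.cod f)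

namespace Term

variable {σ : Signature.{u}}

/-- The word `τ(t)` of the variables of `t`, in order and with repetitions. -/
def vars : {b : σ.Srt} → Term σ b → List σ.V
  | _, .var x => [x]
  | _, .app _ ts => (List.ofFn fun i => (ts i).vars).flatten

/-- Simultaneous sort-preserving substitution of terms for variables. -/
def subst (s : ∀ x : σ.V, Term σ (σ.varSort x)) : {b : σ.Srt} → Term σ b → Term σ b
  | _, .var x => s x
  | _, .app f ts => .app f fun i => (ts i).subst s

theorem vars_arg_subset {f : σ.Op} {ts : ∀ i : Fin (σ.dom f).length, Term σ ((σ.dom f).get i)}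
    {v : List σ.V} (h : (Term.app f ts).vars ⊆ v) (i : Fin (σ.dom f).length) :
    (ts i).vars ⊆ v := by
  intro x hx
  refine h ?_
  simp only [vars, List.mem_flatten, List.mem_ofFn]
  exact ⟨_, ⟨i, rfl⟩, hx⟩

end Term

/-- An `R`-equation `lhs ≈_ctx rhs`: two terms of the same sort with a common `R`-context. An
`R`-theory is a `Set (REquation σ R)`. -/
structure REquation (σ : Signature.{u}) (R : ContextStructure σ.V) where
  sort : σ.Srt
  ctx : List σ.V
  lhs : Term σ sort
  rhs : Term σ sort
  lhs_ctx : R.rel ctx lhs.vars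
  rhs_ctx : R.rel ctx rhs.vars

/-- `Deduces E v t₁ t₂` says that `t₁ ≈_v t₂` belongs to the smallest set of `R`-equations that
contains `E`, is reflexive, symmetric and transitive in every context, and is closed under
`R`-substitution. In `subst`, for a context `v = v₁⋯vₙ`, the contexts `wᵢ` are indexed by the
variables `vᵢ` (which are distinct), and only the values of `s₁`, `s₂`, `ws` on these matter. -/
inductive Deduces {σ : Signature.{u}} {R : ContextStructure σ.V} (E : Set (REquation σ R)) :
    {b : σ.Srt} → List σ.V → Term σ b → Term σ b → Prop
  | ax (e : REquation σ R) (he : e ∈ E) : Deduces E e.ctx e.lhs e.rhs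
  | refl {b : σ.Srt} (v : List σ.V) (t : Term σ b) (h : R.rel v t.vars) : Deduces E v t t
  | symm {b : σ.Srt} {v : List σ.V} {t t' : Term σ b} : Deduces E v t t' → Deduces E v t' t
  | trans {b : σ.Srt} {v : List σ.V} {t₁ t₂ t₃ : Term σ b} :
      Deduces E v t₁ t₂ → Deduces E v t₂ t₃ → Deduces E v t₁ t₃
  | subst {b : σ.Srt} {v : List σ.V} {t₁ t₂ : Term σ b}
      (s₁ s₂ : ∀ x : σ.V, Term σ (σ.varSort x)) (ws : σ.V → List σ.V) (w : List σ.V) :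
      Deduces E v t₁ t₂ →
      R.rel w (v.flatMap ws) →
      (∀ x ∈ v, R.rel (ws x) (s₁ x).vars) →
      (∀ x ∈ v, R.rel (ws x) (s₂ x).vars) →
      (∀ x ∈ v, Deduces E (ws x) (s₁ x) (s₂ x)) →
      Deduces E w (t₁.subst s₁) (t₂.subst s₂)

/-- `E ⊢_R φ`. -/
def Proves {σ : Signature.{u}} {R : ContextStructure σ.V} (E : Set (REquation σ R))
    (φ : REquation σ R) : Prop :=
  Deduces E φ.ctx φ.lhs φ.rhs

/-- A model of the signature in the cartesian multicategory of sets, whose multimorphisms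
`a₁ ⋯ aₙ → b` are the functions `a₁ × ⋯ × aₙ → b`. Sorts may be interpreted by empty sets. -/
structure SetModel (σ : Signature.{u}) where
  carrier : σ.Srt → Type u
  op : ∀ f : σ.Op, (∀ i : Fin (σ.dom f).length, carrier ((σ.dom f).get i)) → carrier (σ.cod f)

namespace SetModel

variable {σ : Signature.{u}}

/-- The set `m_v = m(s₁) × ⋯ × m(sₙ)` for a context `v = x₁⋯xₙ` with `xᵢ : sᵢ`. The factors are
indexed by the variables in `v`, which are distinct. -/
def Env (m : SetModel σ) (v : List σ.V) : Type u :=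
  ∀ x : σ.V, x ∈ v → m.carrier (σ.varSort x)

/-- The reindexing map `m_v → m_w` when all variables of `w` occur in `v`; precomposition with it
is the action `f ↦ f * m_{v,w}` of the cartesian multicategory of sets. -/
def Env.restrict {m : SetModel σ} {v w : List σ.V} (h : w ⊆ v) (ρ : m.Env v) : m.Env w :=
  fun x hx => ρ x (h hx)

/-- The function `m_v(t) : m_v → m(b)` for a term `t : b` whose variables occur in `v`. -/
def interp (m : SetModel σ) (v : List σ.V) :
    {b : σ.Srt} → (t : Term σ b) → t.vars ⊆ v → m.Env v → m.carrier b
  | _, .var x, h => fun ρ => ρ x (h (by simp [Term.vars]))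
  | _, .app f ts, h => fun ρ => m.op f fun i => m.interp v (ts i) (Term.vars_arg_subset h i) ρ

theorem interp_restrict (m : SetModel σ) {v w : List σ.V} (hwv : w ⊆ v) {b : σ.Srt}
    (t : Term σ b) (h : t.vars ⊆ w) (ρ : m.Env v) :
    m.interp w t h (ρ.restrict hwv) = m.interp v t (List.Subset.trans h hwv) ρ := by
  induction t with
  | var x => rfl
  | app f ts ih =>
    simp only [interp]
    congr 1
    funext i
    exact ih i _

/-- The clause `m_v(f(t₁,…,tₖ)) = (m(f) ∘ (m_{w₁}(t₁),…,m_{wₖ}(tₖ))) * m_{v,w₁⋯wₖ}`. -/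
theorem interp_app (m : SetModel σ) {v : List σ.V} {f : σ.Op}
    (ts : ∀ i : Fin (σ.dom f).length, Term σ ((σ.dom f).get i)) (h : (Term.app f ts).vars ⊆ v)
    (w : Fin (σ.dom f).length → List σ.V) (hw : ∀ i, (ts i).vars ⊆ w i) (hwv : ∀ i, w i ⊆ v)
    (ρ : m.Env v) :
    m.interp v (.app f ts) h ρ =
      m.op f fun i => m.interp (w i) (ts i) (hw i) (ρ.restrict (hwv i)) := by
  simp only [interp, interp_restrict]

/-- `m ⊨ t₁ ≈_v t₂`, i.e. `m_v(t₁) = m_v(t₂)`. -/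
def Satisfies (m : SetModel σ) {R : ContextStructure σ.V} (e : REquation σ R) : Prop :=
  m.interp e.ctx e.lhs (R.subset e.lhs_ctx) = m.interp e.ctx e.rhs (R.subset e.rhs_ctx)

/-- `m ⊨ E`. -/
def SatisfiesTheory (m : SetModel σ) {R : ContextStructure σ.V} (E : Set (REquation σ R)) : Prop :=
  ∀ e ∈ E, m.Satisfies e

end SetModel

/-- `E ⊨_Set φ`: the equation `φ` holds in every model of `E` in sets. -/
def SetEntails {σ : Signature.{u}} {R : ContextStructure σ.V} (E : Set (REquation σ R))
    (φ : REquation σ R) : Prop :=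
  ∀ m : SetModel σ, m.SatisfiesTheory E → m.Satisfies φ

/-! Soundness is an induction on deductions; the closure rule holds because evaluation commutes with
substitution (`interp_subst`). Completeness evaluates `φ` at its own variables in a quotient of
terms. In the cartesian case the terms are those over the context of `φ`, modulo deducibility in
that context. In the balanced case all terms are used, and two are identified when every context of
either one proves them equal. Modelability makes this a congruence. For an axiom in context `v` with
a side whose variable word is `u`, a context `w` of the instantiated side must also be a context of
the instantiated `v` (`Balanced.rel_flatMap_of_rel`). If `u` has no repetition, it is a context with
the letters of `v`, and the relation between such contexts is symmetric. If `u` repeats a letter,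
duplication is admissible, every word has a context, and terminal contexts allow the comparison with
`w`. -/

namespace ContextStructure

/-! ### Combinatorics of context structures. -/

variable {V : Type u} {R : ContextStructure V}

theorem rel_trans {a b c : List V} (h₁ : R.rel a b) (h₂ : R.rel b c) : R.rel a c := by
  have := R.comp (c := a) (vs := [b]) (ws := [c]) (by simpa using h₁)
    (List.Forall₂.cons h₂ List.Forall₂.nil)
  simpa using this

theorem rel_append {a b c b' c' : List V} (h : R.rel a (b ++ c)) (hb : R.rel b b')
    (hc : R.rel c c') : R.rel a (b' ++ c') := by
  have := R.comp (c := a) (vs := [b, c]) (ws := [b', c']) (by simpa using h)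
    (.cons hb (.cons hc .nil))
  simpa using this

theorem rel_flatMap {ι : Type*} {w : List V} (l : List ι) (f g : ι → List V)
    (h : R.rel w (l.flatMap f)) (hfg : ∀ i ∈ l, R.rel (f i) (g i)) : R.rel w (l.flatMap g) := by
  rw [List.flatMap_def] at h ⊢
  refine R.comp h ?_
  rw [List.forall₂_map_left_iff, List.forall₂_map_right_iff, List.forall₂_same]
  exact hfg

theorem rel_map {c v : List V} (g : V → V) (hg : Function.Injective g) (h : R.rel c v) :
    R.rel (c.map g) (v.map g) := by
  have := R.subst (d := c.map g) (fun x => [g x]) h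
    (by rw [← List.map_eq_flatMap]; exact R.refl ((R.nodup h).map hg))
  rwa [← List.map_eq_flatMap] at this

theorem Modelable.exists_append (hmod : R.Modelable) {c u v : List V} (h : R.rel c (u ++ v)) :
    ∃ a b, R.rel c (a ++ b) ∧ R.rel a u ∧ R.rel b v := by
  obtain ⟨cs, hcs, hf⟩ := hmod c [u, v] (by simpa using h)
  rcases hf with _ | ⟨ha, hf⟩
  rcases hf with _ | ⟨hb, hf⟩
  cases hf
  exact ⟨_, _, by simpa using hcs, ha, hb⟩

theorem Modelable.exists_flatMap (hmod : R.Modelable) {ι : Type*} [DecidableEq ι] {w : List V}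
    (l : List ι) (hl : l.Nodup) (g : ι → List V) (h : R.rel w (l.flatMap g)) :
    ∃ f : ι → List V, R.rel w (l.flatMap f) ∧ ∀ i ∈ l, R.rel (f i) (g i) := by
  rw [List.flatMap_def] at h
  obtain ⟨cs, hcs, hf⟩ := hmod w _ h
  have key : ∀ (l : List ι), l.Nodup → ∀ cs, List.Forall₂ R.rel cs (l.map g) →
      ∃ f : ι → List V, cs = l.map f ∧ ∀ i ∈ l, R.rel (f i) (g i) := by
    intro l hl
    induction l with
    | nil =>
      intro cs hf
      cases hf
      exact ⟨fun _ => [], by simp⟩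
    | cons a l ih =>
      intro cs hf
      rcases hf with _ | @⟨c, _, _, _, ha, hf⟩
      obtain ⟨f, rfl, hr⟩ := ih (List.nodup_cons.1 hl).2 _ hf
      have hne : ∀ i ∈ l, i ≠ a := by
        rintro i hi rfl
        exact (List.nodup_cons.1 hl).1 hi
      refine ⟨Function.update f a c, ?_, ?_⟩
      · rw [List.map_cons, Function.update_self]
        congr 1
        exact List.map_congr_left fun i hi => (Function.update_of_ne (hne i hi) _ _).symm
      · intro i hi
        rcases List.mem_cons.1 hi with rfl | hi
        · rwa [Function.update_self]
        · rw [Function.update_of_ne (hne i hi)]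
          exact hr i hi
  obtain ⟨f, rfl, hr⟩ := key l hl cs hf
  exact ⟨f, by rwa [List.flatMap_def], hr⟩

/-- By balance `d` is `c` with its letters permuted by some `g` of finite order `n`. Iterating gives
`c R gᵏc` for all `k`; applying `g` to the case `k = n - 1` yields `d R c`. -/
theorem Balanced.rel_symm (hbal : R.Balanced) {c d : List V} (hd : d.Nodup) (h : R.rel c d) :
    R.rel d c := by
  classical
  have hc := R.nodup h
  have hp : c.Perm d := (List.perm_ext_iff_of_nodup hc hd).2 (hbal c d h)
  -- Sends the letter at position `i` of `c` to the letter at position `i` of `d`. It acts on a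
  -- finite set, hence has finite order; `g` extends it by the identity.
  let e : Equiv.Perm {x // x ∈ c} :=
    (hc.getEquiv c).symm.trans ((finCongr hp.length_eq).trans
      ((hd.getEquiv d).trans (Equiv.subtypeEquivRight fun x => (hbal c d h x).symm)))
  let g : Equiv.Perm V := Equiv.Perm.ofSubtype e
  have hg : c.map g = d := by
    refine List.ext_getElem (by simp [hp.length_eq]) fun i h₁ h₂ => ?_
    have hi : i < c.length := by simpa using h₁
    have : (c)[i] ∈ c := List.getElem_mem hi
    rw [List.getElem_map]
    change Equiv.Perm.ofSubtype e (c)[i] = _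
    rw [Equiv.Perm.ofSubtype_apply_of_mem e this]
    have h3 : (hc.getEquiv c).symm ⟨(c)[i], this⟩ = ⟨i, hi⟩ := by
      rw [Equiv.symm_apply_eq]; rfl
    simp only [e, Equiv.trans_apply, h3]
    rfl
  have hiter : ∀ k : ℕ, R.rel c (c.map (g ^ k : Equiv.Perm V)) := by
    intro k
    induction k with
    | zero => simpa using R.refl hc
    | succ k ih =>
      refine rel_trans ih ?_
      have := rel_map _ (g ^ k : Equiv.Perm V).injective h
      rw [← hg, List.map_map] at this
      rwa [pow_succ, Equiv.Perm.coe_mul]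
  have hpos : 0 < orderOf e := orderOf_pos e
  have hone : g * g ^ (orderOf e - 1) = 1 := by
    rw [← pow_succ', Nat.sub_add_cancel hpos]
    change (Equiv.Perm.ofSubtype e) ^ _ = 1
    rw [← map_pow, pow_orderOf_eq_one, map_one]
  have := rel_map g g.injective (hiter (orderOf e - 1))
  rw [hg, List.map_map, ← Equiv.Perm.coe_mul, hone] at this
  simpa using this

theorem Balanced.rel_of_rel (hbal : R.Balanced) (hterm : R.HasTerminalContexts) {c d u : List V}
    (hc : R.rel c u) (hd : R.rel d u) : R.rel c d := by
  obtain ⟨t, ht, h⟩ := hterm u ⟨c, hc⟩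
  exact rel_trans ((h c (R.nodup hc)).2 hc)
    (hbal.rel_symm ht ((h d (R.nodup hd)).2 hd))

theorem flatMap_ite_singleton [DecidableEq V] (x : V) (l : List V) :
    (l.flatMap fun y => if y = x then [x] else []) = List.replicate (l.count x) x := by
  induction l with
  | nil => simp
  | cons a l ih =>
    rw [List.flatMap_cons, ih]
    by_cases h : a = x
    · subst h
      simp [List.replicate_succ]
    · simp [h]

/-- Erasing every letter except a repeated `x` turns `c` into `x` and `u` into a power of `x`.
Modelability splits off a context of `xx`, which balance forces to be `x`; then rename `x` to `y`.
-/
theorem Balanced.rel_duplicate (hbal : R.Balanced) (hmod : R.Modelable) {c u : List V}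
    (h : R.rel c u) (hu : ¬ u.Nodup) (y : V) : R.rel [y] [y, y] := by
  classical
  obtain ⟨x, hx⟩ : ∃ x, 1 < u.count x := by
    by_contra! hcon
    exact hu (List.nodup_iff_count_le_one.2 hcon)
  have hxc : x ∈ c := (hbal c u h x).2 (List.count_pos_iff.1 (by omega))
  have h₁ := R.subst (d := [x]) (fun y => if y = x then [x] else []) h (by
    rw [flatMap_ite_singleton, List.count_eq_one_of_mem (R.nodup h) hxc]
    exact R.refl (by simp))
  rw [flatMap_ite_singleton] at h₁
  have h₂ : List.replicate (u.count x) x = [x, x] ++ List.replicate (u.count x - 2) x := by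
    have h3 : u.count x = 2 + (u.count x - 2) := by omega
    conv_lhs => rw [h3, List.replicate_add]
    rfl
  rw [h₂] at h₁
  obtain ⟨a, b, -, ha, -⟩ := hmod.exists_append h₁
  have hax : a = [x] := by
    refine List.perm_singleton.1
      ((List.perm_ext_iff_of_nodup (R.nodup ha) (by simp)).2 fun z => ?_)
    rw [hbal a _ ha z]
    simp
  subst hax
  have := R.subst (d := [y]) (fun _ => [y]) ha (by simpa using R.refl (c := [y]) (by simp))
  simpa using this

theorem exists_rel_of_rel_duplicate (hmod : R.Modelable) (hdup : ∀ y : V, R.rel [y] [y, y])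
    (u : List V) : ∃ c, R.rel c u := by
  classical
  induction u using List.reverseRecOn with
  | nil => exact ⟨[], R.refl (by simp)⟩
  | append_singleton u x ih =>
    obtain ⟨c, hc⟩ := ih
    have hcn := R.nodup hc
    suffices h : ∃ w, R.rel w (c ++ [x]) by
      obtain ⟨w, hw⟩ := h
      exact ⟨w, rel_append hw hc (R.refl (by simp))⟩
    by_cases hx : x ∈ c
    · obtain ⟨a, b, rfl⟩ := List.append_of_mem hx
      -- Doubling the tail from `x` on places a second `x` after all of `c`; the surplus `b` is then
      -- cut off by modelability.
      have h₁ : R.rel (x :: b) ((x :: b) ++ (x :: b)) := by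
        have := R.subst (d := x :: b) (fun _ => x :: b) (hdup x)
          (by simpa using R.refl (List.nodup_append.1 hcn).2.1)
        simpa using this
      have h₂ : R.rel (a ++ x :: b) ((a ++ x :: b ++ [x]) ++ b) := by
        have := rel_append (R.refl hcn) (R.refl (List.nodup_append.1 hcn).1) h₁
        simpa using this
      obtain ⟨d, -, -, hd, -⟩ := hmod.exists_append h₂
      exact ⟨d, hd⟩
    · exact ⟨c ++ [x], R.refl (by simp [List.nodup_append, hcn]; rintro a ha rfl; exact hx ha)⟩

/-- This reverses axiom (4): a context of the instantiated word is one of the instantiated context.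
In the case with repetitions, any context `d` of the target is also a context of `u.flatMap s`, so
`w R d`. -/
theorem Balanced.rel_flatMap_of_rel (hbal : R.Balanced) (hmod : R.Modelable)
    (hterm : R.HasTerminalContexts) {v u w : List V} (h : R.rel v u) (s : V → List V)
    (hw : R.rel w (u.flatMap s)) : R.rel w (v.flatMap s) := by
  by_cases hu : u.Nodup
  · exact R.subst s (hbal.rel_symm hu h) hw
  · obtain ⟨d, hd⟩ := exists_rel_of_rel_duplicate hmod (hbal.rel_duplicate hmod h hu)
      (v.flatMap s)
    exact rel_trans (hbal.rel_of_rel hterm hw (R.subst s h hd)) hd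

end ContextStructure

theorem List.flatMap_subset_of_forall {α β : Type*} {l : List α} {f : α → List β} {c : List β}
    (h : ∀ a ∈ l, f a ⊆ c) : l.flatMap f ⊆ c := by
  intro x hx
  obtain ⟨a, ha, hxa⟩ := List.mem_flatMap.1 hx
  exact h a ha hxa

/-! ### Substitution and variables in terms. -/

namespace Term

variable {σ : Signature.{u}}

theorem vars_app (f : σ.Op) (ts : ∀ i : Fin (σ.dom f).length, Term σ ((σ.dom f).get i)) :
    (Term.app f ts).vars = (List.finRange _).flatMap fun i => (ts i).vars := by
  rw [vars, List.ofFn_eq_map, List.flatMap_def]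

theorem vars_subst (s : ∀ x : σ.V, Term σ (σ.varSort x)) {b : σ.Srt} (t : Term σ b) :
    (t.subst s).vars = t.vars.flatMap fun x => (s x).vars := by
  induction t with
  | var x => simp [subst, vars]
  | app f ts ih =>
    rw [subst, vars_app, vars_app, List.flatMap_assoc]
    congr 1
    funext i
    exact ih i

theorem subst_var {b : σ.Srt} (t : Term σ b) : t.subst Term.var = t := by
  induction t with
  | var x => rfl
  | app f ts ih =>
    rw [subst]
    congr 1
    funext i
    exact ih i

/-- A variable regarded as a term of a sort equal to its own. -/
def varOf {b : σ.Srt} (x : σ.V) (h : σ.varSort x = b) : Term σ b :=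
  h ▸ Term.var x

theorem vars_varOf {b : σ.Srt} (x : σ.V) (h : σ.varSort x = b) : (varOf x h).vars = [x] := by
  subst h
  rfl

theorem subst_varOf {b : σ.Srt} (x : σ.V) (h : σ.varSort x = b)
    (s : ∀ x : σ.V, Term σ (σ.varSort x)) : (varOf x h).subst s = h ▸ s x := by
  subst h
  rfl

end Term

theorem Signature.exists_injective_varSort (σ : Signature.{u}) (l : List σ.Srt) :
    ∃ x : Fin l.length → σ.V, Function.Injective x ∧ ∀ i, σ.varSort (x i) = l.get i := by
  have g : ∀ s, ℕ ↪ {x : σ.V // σ.varSort x = s} := fun s =>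
    haveI := σ.infinite_fiber s
    Infinite.natEmbedding _
  refine ⟨fun i => (g (l.get i) i).1, ?_, fun i => (g (l.get i) i).2⟩
  intro i j hij
  have hs : l.get i = l.get j := by
    rw [← (g (l.get i) i).2, ← (g (l.get j) j).2]
    exact congrArg σ.varSort hij
  have key : ∀ (s s' : σ.Srt) (m n : ℕ), s = s' → (g s m).1 = (g s' n).1 → m = n := by
    rintro s _ m n rfl h
    exact (g s).injective (Subtype.ext h)
  exact Fin.ext (key _ _ _ _ hs hij)

/-! ### Derived rules of deduction. -/

namespace Deduces

variable {σ : Signature.{u}} {R : ContextStructure σ.V} {E : Set (REquation σ R)}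

theorem rel {b : σ.Srt} {v : List σ.V} {t t' : Term σ b} (h : Deduces E v t t') :
    R.rel v t.vars ∧ R.rel v t'.vars := by
  induction h with
  | ax e he => exact ⟨e.lhs_ctx, e.rhs_ctx⟩
  | refl v t h => exact ⟨h, h⟩
  | symm _ ih => exact ih.symm
  | trans _ _ ih₁ ih₂ => exact ⟨ih₁.1, ih₂.2⟩
  | subst s₁ s₂ ws w _ hw h₁ h₂ _ ih _ =>
    rw [Term.vars_subst, Term.vars_subst]
    exact ⟨R.subst _ ih.1 (ContextStructure.rel_flatMap _ _ _ hw h₁),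
      R.subst _ ih.2 (ContextStructure.rel_flatMap _ _ _ hw h₂)⟩

/-- Congruence is the substitution rule applied to reflexivity of `f(x₁,…,xₙ)` with distinct
variables; the casts only match the sort of `xᵢ` with that of the argument. -/
theorem app {f : σ.Op} {ts ts' : ∀ i : Fin (σ.dom f).length, Term σ ((σ.dom f).get i)}
    {w : List σ.V} (cs : Fin (σ.dom f).length → List σ.V)
    (hw : R.rel w ((List.finRange _).flatMap cs)) (h : ∀ i, Deduces E (cs i) (ts i) (ts' i)) :
    Deduces E w (.app f ts) (.app f ts') := by
  classical
  obtain ⟨x, hx, hsort⟩ := σ.exists_injective_varSort (σ.dom f)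
  have hext : ∀ r : (∀ i : Fin (σ.dom f).length, Term σ ((σ.dom f).get i)),
      ∃ s : ∀ y : σ.V, Term σ (σ.varSort y), ∀ i, s (x i) = (hsort i).symm ▸ r i := by
    intro r
    refine ⟨fun y => if hy : ∃ i, x i = y then
      (hy.choose_spec ▸ (hsort hy.choose).symm) ▸ r hy.choose else .var y, fun i => ?_⟩
    have hy : ∃ j, x j = x i := ⟨i, rfl⟩
    simp only [dif_pos hy]
    have key : ∀ j (hj : j = i) (h' : (σ.dom f).get j = σ.varSort (x i)),
        (h' ▸ r j : Term σ (σ.varSort (x i))) = (hsort i).symm ▸ r i := by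
      rintro _ rfl h'
      rfl
    exact key _ (hx hy.choose_spec) _
  have hcast : ∀ (a b : σ.Srt) (e : a = b) (t : Term σ b), e ▸ (e.symm ▸ t : Term σ a) = t := by
    rintro a _ rfl t
    rfl
  have hded : ∀ (a b : σ.Srt) (e : a = b) (c : List σ.V) (t t' : Term σ b), Deduces E c t t' →
      Deduces E c (e.symm ▸ t : Term σ a) (e.symm ▸ t') := by
    rintro a _ rfl c t t' h
    exact h
  obtain ⟨s, hs⟩ := hext ts
  obtain ⟨s', hs'⟩ := hext ts'
  obtain ⟨ws, hws⟩ : ∃ ws : σ.V → List σ.V, ∀ i, ws (x i) = cs i :=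
    ⟨Function.extend x cs fun _ => [], fun i => hx.extend_apply _ _ i⟩
  let t₀ : Term σ (σ.cod f) := .app f fun i => Term.varOf (x i) (hsort i)
  have ht₀ : t₀.vars = (List.finRange _).map x := by
    simp only [t₀, Term.vars_app, Term.vars_varOf]
    rw [← List.map_eq_flatMap]
  have hv : R.rel ((List.finRange _).map x) t₀.vars := by
    rw [ht₀]
    exact R.refl ((List.nodup_finRange _).map hx)
  have hsub : ∀ y ∈ (List.finRange _).map x, Deduces E (ws y) (s y) (s' y) := by
    intro y hy
    obtain ⟨i, -, rfl⟩ := List.mem_map.1 hy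
    rw [hs, hs', hws]
    exact hded _ _ (hsort i) _ _ _ (h i)
  have := Deduces.subst s s' ws w (.refl _ t₀ hv) (by
      rw [List.flatMap_map]
      simpa only [hws] using hw)
    (fun y hy => (hsub y hy).rel.1) (fun y hy => (hsub y hy).rel.2) hsub
  simpa only [t₀, Term.subst, Term.subst_varOf, hs, hs', hcast] using this

end Deduces

/-! ### Soundness and term models. -/

namespace SetModel

variable {σ : Signature.{u}}

theorem interp_subst (m : SetModel σ) {v w : List σ.V} (s : ∀ x : σ.V, Term σ (σ.varSort x))
    (hs : ∀ x ∈ v, (s x).vars ⊆ w) {b : σ.Srt} (t : Term σ b) (ht : t.vars ⊆ v)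
    (h : (t.subst s).vars ⊆ w) (ρ : m.Env w) :
    m.interp w (t.subst s) h ρ = m.interp v t ht fun x hx => m.interp w (s x) (hs x hx) ρ := by
  induction t with
  | var x => rfl
  | app f ts ih =>
    simp only [Term.subst, interp]
    congr 1
    funext i
    exact ih i _ _

theorem interp_eq_of_deduces (m : SetModel σ) {R : ContextStructure σ.V}
    {E : Set (REquation σ R)} (hE : m.SatisfiesTheory E) {b : σ.Srt} {v : List σ.V}
    {t t' : Term σ b} (h : Deduces E v t t') :
    ∀ (ht : t.vars ⊆ v) (ht' : t'.vars ⊆ v), m.interp v t ht = m.interp v t' ht' := by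
  induction h with
  | ax e he => exact fun _ _ => hE e he
  | refl v t h => exact fun _ _ => rfl
  | symm _ ih => exact fun ht ht' => (ih ht' ht).symm
  | trans h₁ _ ih₁ ih₂ =>
    exact fun ht ht' => (ih₁ ht (R.subset h₁.rel.2)).trans (ih₂ _ ht')
  | @subst b v t₁ t₂ s₁ s₂ ws w h hw h₁ h₂ _ ih ihs =>
    intro ht ht'
    have hws : ∀ x ∈ v, ws x ⊆ w := fun x hx y hy =>
      R.subset hw (List.mem_flatMap.2 ⟨x, hx, hy⟩)
    funext ρ
    rw [m.interp_subst s₁ (fun x hx => List.Subset.trans (R.subset (h₁ x hx)) (hws x hx)) t₁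
        (R.subset h.rel.1),
      m.interp_subst s₂ (fun x hx => List.Subset.trans (R.subset (h₂ x hx)) (hws x hx)) t₂
        (R.subset h.rel.2), ih _ (R.subset h.rel.2)]
    congr 1
    funext x hx
    rw [← m.interp_restrict (hws x hx) (s₁ x) (R.subset (h₁ x hx)),
      ← m.interp_restrict (hws x hx) (s₂ x) (R.subset (h₂ x hx)), ihs x hx]

/-- The model whose elements are the terms with property `P` up to an equivalence relation. -/
noncomputable def termModel (P : ∀ b : σ.Srt, Term σ b → Prop)
    (r : ∀ b : σ.Srt, Setoid {t : Term σ b // P b t})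
    (happ : ∀ f ts, (∀ i, P _ (ts i)) → P _ (Term.app f ts)) : SetModel σ where
  carrier b := Quotient (r b)
  -- Chosen representatives make the operation defined without any congruence property; `hcongr`
  -- enters only when evaluating.
  op f args := Quotient.mk _
    ⟨.app f fun i => (args i).out.1, happ f _ fun i => (args i).out.2⟩

section TermModel

variable {P : ∀ b : σ.Srt, Term σ b → Prop} {r : ∀ b : σ.Srt, Setoid {t : Term σ b // P b t}}
  {happ : ∀ f ts, (∀ i, P _ (ts i)) → P _ (Term.app f ts)}

theorem interp_termModel
    (hcongr : ∀ f ts ts' (h : ∀ i, P _ (ts i)) (h' : ∀ i, P _ (ts' i)),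
      (∀ i, r _ ⟨ts i, h i⟩ ⟨ts' i, h' i⟩) →
        r _ ⟨.app f ts, happ f ts h⟩ ⟨.app f ts', happ f ts' h'⟩)
    {v : List σ.V} (s : ∀ x : σ.V, Term σ (σ.varSort x)) (hs : ∀ x ∈ v, P _ (s x))
    {b : σ.Srt} (t : Term σ b) (ht : t.vars ⊆ v) :
    ∃ h : P _ (t.subst s), (termModel P r happ).interp v t ht
      (fun x hx => Quotient.mk (r _) ⟨s x, hs x hx⟩) = Quotient.mk (r _) ⟨t.subst s, h⟩ := by
  induction t with
  | var x => exact ⟨hs x (ht (by simp [Term.vars])), rfl⟩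
  | app f ts ih =>
    choose h₁ h₂ using fun i => ih i (Term.vars_arg_subset ht i)
    refine ⟨happ f _ h₁, ?_⟩
    simp only [interp]
    refine Quotient.sound (hcongr f _ _ (fun i => (Quotient.out (s := r _) _).2) h₁ fun i => ?_)
    refine Quotient.exact (s := r _) ?_
    exact (Quotient.out_eq _).trans (h₂ i)

/-- Every environment lifts to an assignment of representatives, so only substitution instances need
checking. -/
theorem termModel_satisfies {R : ContextStructure σ.V}
    (hcongr : ∀ f ts ts' (h : ∀ i, P _ (ts i)) (h' : ∀ i, P _ (ts' i)),
      (∀ i, r _ ⟨ts i, h i⟩ ⟨ts' i, h' i⟩) →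
        r _ ⟨.app f ts, happ f ts h⟩ ⟨.app f ts', happ f ts' h'⟩)
    (e : REquation σ R)
    (he : ∀ s : (∀ x : σ.V, Term σ (σ.varSort x)), (∀ x ∈ e.ctx, P _ (s x)) →
      ∀ h h', r _ ⟨e.lhs.subst s, h⟩ ⟨e.rhs.subst s, h'⟩) :
    (termModel P r happ).Satisfies e := by
  classical
  unfold Satisfies
  funext ρ
  obtain ⟨s, hs, rfl⟩ : ∃ (s : ∀ x : σ.V, Term σ (σ.varSort x)) (hs : ∀ x ∈ e.ctx, P _ (s x)),
      ρ = fun x hx => Quotient.mk (r _) ⟨s x, hs x hx⟩ := by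
    refine ⟨fun x => if hx : x ∈ e.ctx then (Quotient.out (s := r _) (ρ x hx)).1 else .var x,
      fun x hx => ?_, ?_⟩
    · simp only [dif_pos hx]
      exact (Quotient.out (s := r _) (ρ x hx)).2
    · funext x hx
      simp only [dif_pos hx]
      exact (Quotient.out_eq (s := r _) (ρ x hx)).symm
  obtain ⟨h₁, e₁⟩ := interp_termModel hcongr s hs e.lhs (R.subset e.lhs_ctx)
  obtain ⟨h₂, e₂⟩ := interp_termModel hcongr s hs e.rhs (R.subset e.rhs_ctx)
  rw [e₁, e₂]
  exact Quotient.sound (he s hs h₁ h₂)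

/-- At the environment of classes of variables, each term evaluates to its own class. -/
theorem rel_of_termModel_satisfies {R : ContextStructure σ.V}
    (hcongr : ∀ f ts ts' (h : ∀ i, P _ (ts i)) (h' : ∀ i, P _ (ts' i)),
      (∀ i, r _ ⟨ts i, h i⟩ ⟨ts' i, h' i⟩) →
        r _ ⟨.app f ts, happ f ts h⟩ ⟨.app f ts', happ f ts' h'⟩)
    (e : REquation σ R) (hvar : ∀ x ∈ e.ctx, P _ (.var x))
    (he : (termModel P r happ).Satisfies e) :
    ∃ h h', r _ ⟨e.lhs, h⟩ ⟨e.rhs, h'⟩ := by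
  obtain ⟨h₁, e₁⟩ := interp_termModel hcongr Term.var hvar e.lhs (R.subset e.lhs_ctx)
  obtain ⟨h₂, e₂⟩ := interp_termModel hcongr Term.var hvar e.rhs (R.subset e.rhs_ctx)
  have h := e₁.symm.trans ((congrFun he _).trans e₂)
  have h' := Quotient.exact h
  simp only [Term.subst_var] at h₁ h₂ h'
  exact ⟨h₁, h₂, h'⟩

end TermModel

end SetModel

/-! ### Completeness in the two cases. -/

theorem proves_of_setEntails_cartesian {σ : Signature.{u}}
    (E : Set (REquation σ (ContextStructure.cartesian σ.V)))
    (φ : REquation σ (ContextStructure.cartesian σ.V)) (h : SetEntails E φ) : Proves E φ := by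
  have hφ : φ.ctx.Nodup := φ.lhs_ctx.1
  -- Admitting only the variables of `φ.ctx` keeps a single context valid for all terms, and lets
  -- sorts without such terms be empty.
  let r : ∀ b : σ.Srt, Setoid {t : Term σ b // t.vars ⊆ φ.ctx} := fun b =>
    { r := fun t t' => Deduces E φ.ctx t.1 t'.1
      iseqv := ⟨fun t => .refl _ _ ⟨hφ, t.2⟩, fun h => h.symm, fun h₁ h₂ => h₁.trans h₂⟩ }
  have happ : ∀ f (ts : ∀ i : Fin (σ.dom f).length, Term σ ((σ.dom f).get i)),
      (∀ i, (ts i).vars ⊆ φ.ctx) → (Term.app f ts).vars ⊆ φ.ctx := by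
    intro f ts hts
    rw [Term.vars_app]
    exact List.flatMap_subset_of_forall fun i _ => hts i
  have hcongr : ∀ f ts ts' (h : ∀ i, (ts i).vars ⊆ φ.ctx) (h' : ∀ i, (ts' i).vars ⊆ φ.ctx),
      (∀ i, r _ ⟨ts i, h i⟩ ⟨ts' i, h' i⟩) →
        r _ ⟨.app f ts, happ f ts h⟩ ⟨.app f ts', happ f ts' h'⟩ := by
    intro f ts ts' _ _ hr
    exact Deduces.app (fun _ => φ.ctx)
      ⟨hφ, List.flatMap_subset_of_forall fun i _ => List.Subset.refl _⟩ hr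
  have hsat : (SetModel.termModel _ r happ).SatisfiesTheory E := by
    intro e he
    refine SetModel.termModel_satisfies hcongr e fun s hs h₁ h₂ => ?_
    exact Deduces.subst s s (fun _ => φ.ctx) φ.ctx (.ax e he)
      ⟨hφ, List.flatMap_subset_of_forall fun i _ => List.Subset.refl _⟩
      (fun x hx => ⟨hφ, hs x hx⟩) (fun x hx => ⟨hφ, hs x hx⟩)
      fun x hx => .refl _ _ ⟨hφ, hs x hx⟩
  obtain ⟨_, _, hr⟩ := SetModel.rel_of_termModel_satisfies hcongr φ
    (fun x hx => by simpa [Term.vars] using hx) (h _ hsat)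
  exact hr

theorem proves_of_setEntails_balanced {σ : Signature.{u}} {R : ContextStructure σ.V}
    (hmod : R.Modelable) (hterm : R.HasTerminalContexts) (hbal : R.Balanced)
    (E : Set (REquation σ R)) (φ : REquation σ R) (h : SetEntails E φ) : Proves E φ := by
  classical
  let r : ∀ b : σ.Srt, Setoid {_t : Term σ b // True} := fun b =>
    -- The disjunction is what gives transitivity: a context of one outer term is, by the deduced
    -- equation, also a context of the middle term.
    { r := fun t t' => (∀ w, R.rel w t.1.vars ∨ R.rel w t'.1.vars → Deduces E w t.1 t'.1)
      iseqv := by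
        refine ⟨fun t w hw => .refl _ _ (or_self_iff.1 hw), fun h w hw => (h w hw.symm).symm,
          fun h₁ h₂ w hw => ?_⟩
        rcases hw with hw | hw
        · have := h₁ w (.inl hw)
          exact this.trans (h₂ w (.inl this.rel.2))
        · have := h₂ w (.inr hw)
          exact (h₁ w (.inr this.rel.1)).trans this }
  have happ : ∀ f (ts : ∀ i : Fin (σ.dom f).length, Term σ ((σ.dom f).get i)),
      (∀ i : Fin (σ.dom f).length, True) → True := fun _ _ _ => trivial
  have hcongr : ∀ f (ts ts' : ∀ i : Fin (σ.dom f).length, Term σ ((σ.dom f).get i))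
      (h h' : ∀ i : Fin (σ.dom f).length, True),
      (∀ i, r _ ⟨ts i, h i⟩ ⟨ts' i, h' i⟩) →
        r _ ⟨.app f ts, happ f ts h⟩ ⟨.app f ts', happ f ts' h'⟩ := by
    intro f ts ts' _ _ hr w hw
    dsimp only at hw ⊢
    rw [Term.vars_app, Term.vars_app] at hw
    rcases hw with hw | hw <;>
      obtain ⟨cs, hcs, hc⟩ := hmod.exists_flatMap _ (List.nodup_finRange _) _ hw
    · exact Deduces.app cs hcs fun i => hr i _ (.inl (hc i (List.mem_finRange i)))
    · exact Deduces.app cs hcs fun i => hr i _ (.inr (hc i (List.mem_finRange i)))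
  have hsat : (SetModel.termModel _ r happ).SatisfiesTheory E := by
    intro e he
    refine SetModel.termModel_satisfies hcongr e fun s _ _ _ w hw => ?_
    -- With this, modelability supplies the contexts of the `s x` required by the substitution rule.
    have hw' : R.rel w (e.ctx.flatMap fun x => (s x).vars) := by
      simp only [Term.vars_subst] at hw
      exact hw.elim (hbal.rel_flatMap_of_rel hmod hterm e.lhs_ctx _)
        (hbal.rel_flatMap_of_rel hmod hterm e.rhs_ctx _)
    obtain ⟨ws, hws, hc⟩ := hmod.exists_flatMap _ (R.nodup e.lhs_ctx) _ hw'
    exact Deduces.subst s s ws w (.ax e he) hws hc hc fun x hx => .refl _ _ (hc x hx)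
  obtain ⟨_, _, hr⟩ := SetModel.rel_of_termModel_satisfies hcongr φ (fun _ _ => trivial)
    (h _ hsat)
  exact hr _ (.inl φ.lhs_ctx)

theorem mainTheorem2 (σ : Signature.{u}) (R : ContextStructure σ.V)
    (hmod : R.Modelable) (hterm : R.HasTerminalContexts)
    (hR : R.Balanced ∨ R = ContextStructure.cartesian σ.V)
    (E : Set (REquation σ R)) (φ : REquation σ R) :
    Proves E φ ↔ SetEntails E φ := by
  refine ⟨fun h m hm => m.interp_eq_of_deduces hm h _ _, fun h => ?_⟩
  rcases hR with hbal | rfl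
  · exact proves_of_setEntails_balanced hmod hterm hbal E φ h
  · exact proves_of_setEntails_cartesian E φ h
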